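/- **Theorem (The Back Door Criterion, one-node intervention).** Let $G$ be a directed acyclic graph with nodes $\mathbf V_1,\dots,\mathbf V_n$, labelled so that every arrow goes from a smaller to a larger label. Let each node $\mathbf V_i$ have a measurable value space $\mathcal V_i$ in which singletons are measurable, and let $U_1,\dots,U_n$ be independent random variables (the disturbances) on a probability space, $U_i$ with values in a measurable space $\mathcal U_i$. Let $f_i:\prod_{\mathbf V_j\in PA_G(\mathbf V_i)}\mathcal V_j\times\mathcal U_i\to\mathcal V_i$ be measurable functions, where $PA_G(\mathbf V_i)$ is the set of parents of $\mathbf V_i$ in $G$. The factual variables are defined by the recurrence $V_i=f_i(PA_i,U_i)$, where $PA_i$ are the factual variables attached to the parents of $\mathbf V_i$. Let $\mathbf A$ and $\mathbf Y$ be nodes with factual variables $A$ and $Y$, and let $a$ be a possible value of $A$ (an element of the value space of $\mathbf A$). The counterfactual variables $V_{a,i}$ are obtained from the same disturbances by the same recurrence, except that the function of the node $\mathbf A$ is replaced by the constant $a$; $Y_a$ is the counterfactual variable attached to $\mathbf Y$. Let $\mathbf L$ be a set of nodes with $\mathbf A\notin\mathbf L$, let $L$ be the vector of factual variables attached to $\mathbf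 L$, and assume: 1. no element of $\mathbf L$ is a descendant of $\mathbf A$ in $G$; 2. $\mathbf L$ blocks all back-door paths from $\mathbf A$ to $\mathbf Y$ in $G$. Here a path is a sequence of distinct nodes in which consecutive nodes are joined by an arrow of either direction. It is a back-door path from $\mathbf A$ to $\mathbf Y$ if it starts at $\mathbf A$, ends at $\mathbf Y$, and its first edge is an arrow pointing into $\mathbf A$. The set $\mathbf L$ blocks a path if some interior node $\mathbf M$ of the path either is a collider on it (both adjacent arrows of the path point into $\mathbf M$) and neither $\mathbf M$ nor any descendant of $\mathbf M$ is in $\mathbf L$, or is not a collider on it and is in $\mathbf L$. Then $Y_a$ is independent of $A$ given $L$ (conditional ignorability). If, moreover, the variables in $L$ are discrete (their value spaces are countable) and positivity holds at $a$, that is, $P(A=a\mid L=\ell)>0$ for every $\ell$ with $P(L=\ell)>0$, then for every $y$ $$P(Y_a=y)=\sum_\ell P(Y=y\mid A=a,\,L=\ell)\,P(L=\ell),$$ where terms with $P(L=\ell)=0$ are read as $0$. -/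

import Mathlib

open MeasureTheory ProbabilityTheory

/-- A directed acyclic graph on the nodes `0, …, n - 1`, labelled compatibly with its arrows:
every arrow goes from a smaller to a larger label. -/
structure DAG (n : ℕ) extends Digraph (Fin n) where
  lt_of_adj : ∀ {i j : Fin n}, Adj i j → i < j

namespace DAG

variable {n : ℕ} (G : DAG n)

/-- The set of parents of the node `i`. -/
def Parents (i : Fin n) : Set (Fin n) := {j | G.Adj j i}

/-- `d` is a descendant of `i`: there is a directed path with at least one arrow from `i` to `d`. -/
def IsDescendant (d i : Fin n) : Prop := Relation.TransGen G.Adj i d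

/-- The undirected graph obtained by forgetting the orientation of the arrows.
A path in a DAG may follow arrows in either direction, so it is a path of the skeleton. -/
def skeleton : SimpleGraph (Fin n) := SimpleGraph.fromRel G.Adj

/-- `L` blocks the path `p` if some interior node `m` of `p`, with neighbours `x` and `z` on `p`,
either is a collider `x → m ← z` such that neither `m` nor any descendant of `m` is in `L`,
or is not a collider and is in `L`. -/
def Blocks (L : Finset (Fin n)) {i j : Fin n} (p : G.skeleton.Walk i j) : Prop :=
  ∃ x m z : Fin n, [x, m, z] <:+: p.support ∧
    ((G.Adj x m ∧ G.Adj z m ∧ m ∉ L ∧ ∀ d, G.IsDescendant d m → d ∉ L) ∨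
      (¬ (G.Adj x m ∧ G.Adj z m) ∧ m ∈ L))

/-- A back-door path from `i` to `j`: a path (no repeated nodes) whose first edge is an arrow
pointing into `i`. -/
def IsBackDoorPath {i j : Fin n} (p : G.skeleton.Walk i j) : Prop :=
  p.IsPath ∧ ¬ p.Nil ∧ G.Adj p.snd i

end DAG

/-- A set of structural functions compatible with `G`: `X i` is the value space of the node `i`,
`U i` that of its disturbance, and `f i` computes the value at `i` from the values at the
parents of `i` and the disturbance. -/
structure StructuralFunctions {n : ℕ} (G : DAG n) (X U : Fin n → Type*)
    [∀ i, MeasurableSpace (X i)] [∀ i, MeasurableSpace (U i)] where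
  f : ∀ i : Fin n, (∀ j : G.Parents i, X j) → U i → X i
  measurable_f : ∀ i : Fin n, Measurable (fun q : (∀ j : G.Parents i, X j) × U i => f i q.1 q.2)

namespace StructuralFunctions

variable {n : ℕ} {G : DAG n} {X U : Fin n → Type*}
  [∀ i, MeasurableSpace (X i)] [∀ i, MeasurableSpace (U i)]

/-- The values at all nodes, by the recurrence `Vᵢ = fᵢ(PAᵢ, Uᵢ)`. -/
def solve (F : StructuralFunctions G X U) (u : ∀ i, U i) (i : Fin n) : X i :=
  F.f i (fun j => solve F u j.1) (u i)
termination_by i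
decreasing_by exact G.lt_of_adj j.2

/-- The surgically modified functions: the function of the node `A` is replaced by the
constant `a`, all the others are unchanged. -/
def intervene (F : StructuralFunctions G X U) (A : Fin n) (a : X A) :
    StructuralFunctions G X U where
  f := Function.update F.f A (fun _ _ => a)
  measurable_f := by
    intro i
    by_cases h : i = A
    · subst h
      simp
    · simpa [Function.update_of_ne h] using F.measurable_f i

/-- The random variable attached to the node `i` by the functions `F` and disturbances `E`. -/
def variableAt (F : StructuralFunctions G X U) {Ω : Type*} (E : ∀ i, Ω → U i) (i : Fin n)
    (ω : Ω) : X i :=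
  F.solve (fun k => E k ω) i

/-- The random vector attached to a set `L` of nodes. -/
def vectorAt (F : StructuralFunctions G X U) {Ω : Type*} (E : ∀ i, Ω → U i)
    (L : Finset (Fin n)) (ω : Ω) (j : L) : X j :=
  F.variableAt E j ω

end StructuralFunctions

/-- `Y` and `A` are conditionally independent given `L`:
`P(Y ∈ s, A ∈ t | σ(L)) = P(Y ∈ s | σ(L)) P(A ∈ t | σ(L))` almost surely, for all measurable
`s`, `t`.  On a standard Borel space `Ω` this is `ProbabilityTheory.CondIndepFun` with respect to
`σ(L)`; the present form does not restrict `Ω`. -/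
def CondIndepGiven {Ω α β γ : Type*} [MeasurableSpace Ω] [MeasurableSpace α] [MeasurableSpace β]
    [MeasurableSpace γ] (P : Measure Ω) (Y : Ω → α) (A : Ω → β) (L : Ω → γ) : Prop :=
  ∀ (s : Set α) (t : Set β), MeasurableSet s → MeasurableSet t →
    P⟦Y ⁻¹' s ∩ A ⁻¹' t | MeasurableSpace.comap L inferInstance⟧ =ᵐ[P]
      P⟦Y ⁻¹' s | MeasurableSpace.comap L inferInstance⟧ *
        P⟦A ⁻¹' t | MeasurableSpace.comap L inferInstance⟧

/-!
Split the node `A`: remove the arrows out of `A` and let the children of `A` receive the constant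
`a` instead. In the split model the variable at `A`, and the variables in `L` since they do not
descend from `A`, are the factual ones, whereas the variable at any `Y ≠ A` is the counterfactual
`Y_a`. All paths of the split graph that start at `A` are back-door paths, so `L` d-separates `A`
and `Y` there (`DAG.dSeparates_removeOut`). Conditional ignorability is therefore an instance of the
global Markov property (`StructuralFunctions.condIndepGiven_of_dSeparates`), applied to the split
model.

The proof of the Markov property needs neither densities nor regular conditional probabilities.
Distribute the disturbances between two parties: the first one gets those of the nodes `v` for which
some node outside `L`, among `v` and its parents, is reached from `A` by an active walk. By
d-separation (`DAG.DSeparates.reaches_of_family`) no relevant node has needs on both sides, so that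
each party can compute its variables from its own disturbances and from the variables in `L`
computed earlier (`StructuralFunctions.measurable_variableAt_party`). The variables in `L` are thus
the transcript of a public conversation between two parties with independent private information,
and each message keeps the private information conditionally independent given the transcript
(`CondIndepSigma.extend_left`). Finally `A` is computed by the first party and `Y` by the second.

D-separation speaks of paths, whereas reachability is convenient for walks with repetitions. A loop
of an active walk can be cut out (`DAG.IsActiveWalk.excise`), because acyclicity forces a loop that
leaves a node along an arrow to meet a collider below this node.

The adjustment formula follows by evaluating conditional independence on the events `L = l`
(`CondIndepGiven.measure_inter_mul`) and by consistency: `Y_a = Y` where `A = a`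
(`StructuralFunctions.variableAt_intervene_of_eq`).
-/

/-! ### Conditional independence of σ-algebras -/

/-- The σ-algebras `m₁` and `m₂` are conditionally independent given the σ-algebra `m`.
Unlike `ProbabilityTheory.CondIndep`, which is stated through a regular conditional probability,
this needs no assumption on `Ω`. -/
def CondIndepSigma {Ω : Type*} (m m₁ m₂ : MeasurableSpace Ω) {mΩ : MeasurableSpace Ω}
    (P : Measure Ω) : Prop :=
  ∀ s t : Set Ω, MeasurableSet[m₁] s → MeasurableSet[m₂] t →
    P⟦s ∩ t | m⟧ =ᵐ[P] P⟦s | m⟧ * P⟦t | m⟧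

namespace CondIndepSigma

variable {Ω : Type*} {m m' m₁ m₂ mΩ : MeasurableSpace Ω} {P : Measure Ω}

theorem symm (h : CondIndepSigma m m₁ m₂ P) : CondIndepSigma m m₂ m₁ P := by
  intro s t hs ht
  rw [Set.inter_comm, mul_comm]
  exact h t s ht hs

theorem _root_.MeasureTheory.integrable_indicator_one [IsFiniteMeasure P] {s : Set Ω}
    (hs : MeasurableSet s) :
    Integrable (s.indicator fun _ => (1 : ℝ)) P :=
  (integrable_const 1).indicator hs

/-- The σ-algebra `m₁ ⊔ m₂` is generated by the π-system of intersections `s ∩ r` with `s` in `m₁`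
and `r` in `m₂`. -/
theorem _root_.MeasurableSpace.sup_eq_generateFrom_inter :
    m₁ ⊔ m₂ = MeasurableSpace.generateFrom
      {u | ∃ s r, MeasurableSet[m₁] s ∧ MeasurableSet[m₂] r ∧ s ∩ r = u} := by
  apply le_antisymm
  · refine sup_le (fun s hs => ?_) (fun s hs => ?_)
    · exact MeasurableSpace.measurableSet_generateFrom
        ⟨s, Set.univ, hs, MeasurableSet.univ, Set.inter_univ s⟩
    · exact MeasurableSpace.measurableSet_generateFrom
        ⟨Set.univ, s, MeasurableSet.univ, hs, Set.univ_inter s⟩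
  · refine MeasurableSpace.generateFrom_le ?_
    rintro _ ⟨s, r, hs, hr, rfl⟩
    exact MeasurableSet.inter (le_sup_left (a := m₁) (b := m₂) s hs)
      (le_sup_right (a := m₁) (b := m₂) r hr)

theorem _root_.MeasurableSpace.isPiSystem_inter :
    IsPiSystem {u : Set Ω | ∃ s r, MeasurableSet[m₁] s ∧ MeasurableSet[m₂] r ∧ s ∩ r = u} := by
  rintro _ ⟨s, r, hs, hr, rfl⟩ _ ⟨s', r', hs', hr', rfl⟩ -
  exact ⟨s ∩ s', r ∩ r', hs.inter hs', hr.inter hr', Set.inter_inter_inter_comm _ _ _ _⟩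

/-- Under conditional independence, observing `m₁` in addition to `m` does not change the
conditional probability of an event of `m₂`. -/
theorem condExp_sup_ae_eq [IsFiniteMeasure P] (hm : m ≤ mΩ) (hm₁ : m₁ ≤ mΩ) (hm₂ : m₂ ≤ mΩ)
    (h : CondIndepSigma m m₁ m₂ P) {t : Set Ω} (ht : MeasurableSet[m₂] t) :
    P⟦t | m₁ ⊔ m⟧ =ᵐ[P] P⟦t | m⟧ := by
  have ht' : MeasurableSet t := hm₂ t ht
  have hsup : m₁ ⊔ m ≤ mΩ := sup_le hm₁ hm
  have hint := integrable_indicator_one (P := P) ht'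
  have hg : Integrable (P⟦t | m⟧) P := integrable_condExp
  have hgm : StronglyMeasurable[m₁ ⊔ m] (P⟦t | m⟧) :=
    stronglyMeasurable_condExp.mono le_sup_right
  refine (ae_eq_condExp_of_forall_setIntegral_eq hsup hint
    (fun s _ _ => hg.integrableOn) ?_
    hgm.aestronglyMeasurable).symm
  intro u hu _
  induction u, hu using MeasurableSpace.induction_on_inter
    MeasurableSpace.sup_eq_generateFrom_inter MeasurableSpace.isPiSystem_inter with
  | empty => simp
  | basic u hu =>
    obtain ⟨s, r, hs, hr, rfl⟩ := hu
    have hs' : MeasurableSet s := hm₁ s hs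
    have hr' : MeasurableSet r := hm r hr
    have hsg : (s.indicator fun _ => (1 : ℝ)) * P⟦t | m⟧ = s.indicator (P⟦t | m⟧) := by
      ext ω; by_cases hω : ω ∈ s <;> simp [hω]
    have hsgi : Integrable ((s.indicator fun _ => (1 : ℝ)) * P⟦t | m⟧) P := by
      rw [hsg]; exact hg.indicator hs'
    have hpull := condExp_mul_of_stronglyMeasurable_right (μ := P)
      stronglyMeasurable_condExp hsgi (integrable_indicator_one hs')
    calc ∫ x in s ∩ r, (P⟦t | m⟧) x ∂P
        = ∫ x in r, ((s.indicator fun _ => (1 : ℝ)) * P⟦t | m⟧) x ∂P := by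
          rw [hsg, setIntegral_indicator hs', Set.inter_comm]
      _ = ∫ x in r, (P[(s.indicator fun _ => (1 : ℝ)) * P⟦t | m⟧ | m]) x ∂P :=
          (setIntegral_condExp hm hsgi hr).symm
      _ = ∫ x in r, (P⟦s ∩ t | m⟧) x ∂P :=
          setIntegral_congr_ae hr' ((hpull.trans (h s t hs ht).symm).mono fun x hx _ => hx)
      _ = ∫ x in r, (s ∩ t).indicator (fun _ => (1 : ℝ)) x ∂P :=
          setIntegral_condExp hm (integrable_indicator_one (hs'.inter ht')) hr
      _ = ∫ x in s ∩ r, t.indicator (fun _ => (1 : ℝ)) x ∂P := by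
          rw [← Set.indicator_indicator, setIntegral_indicator hs', Set.inter_comm]
  | compl u hu ih =>
    have hu' : MeasurableSet u := hsup u hu
    have h₁ := integral_add_compl hu' hg
    have h₂ := integral_add_compl hu' hint
    have h₃ : ∫ x, (P⟦t | m⟧) x ∂P = ∫ x, t.indicator (fun _ => (1 : ℝ)) x ∂P :=
      integral_condExp hm
    have := ih (measure_lt_top P u)
    linarith
  | iUnion f hd hf ih =>
    have hf' : ∀ i, MeasurableSet (f i) := fun i => hsup _ (hf i)
    rw [integral_iUnion hf' hd hg.integrableOn, integral_iUnion hf' hd hint.integrableOn]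
    exact tsum_congr fun i => ih i (measure_lt_top P _)

/-- The converse of `condExp_sup_ae_eq`. -/
theorem of_condExp_sup_ae_eq [IsFiniteMeasure P] (hm : m ≤ mΩ) (hm₁ : m₁ ≤ mΩ) (hm₂ : m₂ ≤ mΩ)
    (h : ∀ t, MeasurableSet[m₂] t → P⟦t | m₁ ⊔ m⟧ =ᵐ[P] P⟦t | m⟧) :
    CondIndepSigma m m₁ m₂ P := by
  intro s t hs ht
  have hs' : MeasurableSet s := hm₁ s hs
  have ht' : MeasurableSet t := hm₂ t ht
  have hsup : m₁ ⊔ m ≤ mΩ := sup_le hm₁ hm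
  have hst : (s.indicator fun _ => (1 : ℝ)) * (t.indicator fun _ => (1 : ℝ)) =
      (s ∩ t).indicator fun _ => (1 : ℝ) := by
    ext ω; by_cases h₁ : ω ∈ s <;> by_cases h₂ : ω ∈ t <;> simp [h₁, h₂]
  have hsg : (s.indicator fun _ => (1 : ℝ)) * P⟦t | m⟧ = s.indicator (P⟦t | m⟧) := by
    ext ω; by_cases hω : ω ∈ s <;> simp [hω]
  have hsgi : Integrable ((s.indicator fun _ => (1 : ℝ)) * P⟦t | m⟧) P := by
    rw [hsg]; exact integrable_condExp.indicator hs'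
  have hs₁ : StronglyMeasurable[m₁ ⊔ m] (s.indicator fun _ => (1 : ℝ)) :=
    stronglyMeasurable_const.indicator (le_sup_left (a := m₁) (b := m) s hs)
  have hpull₁ : P⟦s ∩ t | m₁ ⊔ m⟧ =ᵐ[P] (s.indicator fun _ => (1 : ℝ)) * P⟦t | m₁ ⊔ m⟧ := by
    rw [← hst]
    exact condExp_mul_of_stronglyMeasurable_left hs₁
      (by rw [hst]; exact integrable_indicator_one (hs'.inter ht')) (integrable_indicator_one ht')
  have hpull₂ := condExp_mul_of_stronglyMeasurable_right (μ := P)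
    stronglyMeasurable_condExp hsgi (integrable_indicator_one hs')
  have htower : P[P⟦s ∩ t | m₁ ⊔ m⟧ | m] =ᵐ[P] P⟦s ∩ t | m⟧ :=
    condExp_condExp_of_le le_sup_right hsup
  refine htower.symm.trans ((condExp_congr_ae ?_).trans hpull₂)
  filter_upwards [hpull₁, h t ht] with ω h₁ h₂
  rw [h₁, Pi.mul_apply, Pi.mul_apply, h₂]

theorem sup_left [IsFiniteMeasure P] (hm : m ≤ mΩ) (hm₁ : m₁ ≤ mΩ) (hm₂ : m₂ ≤ mΩ)
    (h : CondIndepSigma m m₁ m₂ P) : CondIndepSigma m (m₁ ⊔ m) m₂ P := by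
  refine of_condExp_sup_ae_eq hm (sup_le hm₁ hm) hm₂ fun t ht => ?_
  rw [sup_assoc, sup_idem]
  exact h.condExp_sup_ae_eq hm hm₁ hm₂ ht

theorem sup_sup [IsFiniteMeasure P] (hm : m ≤ mΩ) (hm₁ : m₁ ≤ mΩ) (hm₂ : m₂ ≤ mΩ)
    (h : CondIndepSigma m m₁ m₂ P) : CondIndepSigma m (m₁ ⊔ m) (m₂ ⊔ m) P :=
  ((h.sup_left hm hm₁ hm₂).symm.sup_left hm hm₂ (sup_le hm₁ hm)).symm

/-- One round of a public conversation between two parties holding the private information `m₁`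
and `m₂`: if the transcript `m` makes them conditionally independent, then so does the transcript
extended by a message `m'` which the first party computes from `m₁` and `m`. -/
theorem extend_left [IsFiniteMeasure P] (hm : m ≤ mΩ) (hm₁ : m₁ ≤ mΩ) (hm₂ : m₂ ≤ mΩ)
    (h : CondIndepSigma m m₁ m₂ P) (hm' : m' ≤ m₁ ⊔ m) : CondIndepSigma (m ⊔ m') m₁ m₂ P := by
  have hsup : m₁ ⊔ m ≤ mΩ := sup_le hm₁ hm
  have hm'' : m ⊔ m' ≤ m₁ ⊔ m := sup_le le_sup_right hm'
  refine of_condExp_sup_ae_eq (hm''.trans hsup) hm₁ hm₂ fun t ht => ?_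
  have h₀ := h.condExp_sup_ae_eq hm hm₁ hm₂ ht
  have hself : P[P⟦t | m⟧ | m ⊔ m'] = P⟦t | m⟧ :=
    condExp_of_stronglyMeasurable (hm''.trans hsup)
      (stronglyMeasurable_condExp.mono le_sup_left) integrable_condExp
  have htower : P[P⟦t | m₁ ⊔ m⟧ | m ⊔ m'] =ᵐ[P] P⟦t | m ⊔ m'⟧ :=
    condExp_condExp_of_le hm'' hsup
  have h₁ : P⟦t | m ⊔ m'⟧ =ᵐ[P] P⟦t | m⟧ := by
    rw [← hself]
    exact htower.symm.trans (condExp_congr_ae h₀)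
  rw [← sup_assoc, sup_eq_left.2 hm']
  exact h₀.trans h₁.symm

theorem extend_right [IsFiniteMeasure P] (hm : m ≤ mΩ) (hm₁ : m₁ ≤ mΩ) (hm₂ : m₂ ≤ mΩ)
    (h : CondIndepSigma m m₁ m₂ P) (hm' : m' ≤ m₂ ⊔ m) : CondIndepSigma (m ⊔ m') m₁ m₂ P :=
  (h.symm.extend_left hm hm₂ hm₁ hm').symm

theorem of_indep [IsProbabilityMeasure P] (hm₁ : m₁ ≤ mΩ) (hm₂ : m₂ ≤ mΩ)
    (h : Indep m₁ m₂ P) : CondIndepSigma ⊥ m₁ m₂ P := by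
  intro s t hs ht
  refine Filter.Eventually.of_forall fun ω => ?_
  simp only [condExp_bot, Pi.mul_apply]
  rw [integral_indicator_const _ ((hm₁ s hs).inter (hm₂ t ht)),
    integral_indicator_const _ (hm₁ s hs), integral_indicator_const _ (hm₂ t ht)]
  have := (Indep_iff m₁ m₂ P).1 h s t hs ht
  simp [measureReal_def, this]

end CondIndepSigma

/-! ### Active walks and d-separation -/

namespace DAG

variable {n : ℕ} (G : DAG n)

theorem skeleton_adj {i j : Fin n} : G.skeleton.Adj i j ↔ G.Adj i j ∨ G.Adj j i := by
  rw [skeleton, SimpleGraph.fromRel_adj]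
  refine ⟨And.right, fun h => ⟨?_, h⟩⟩
  rintro rfl
  exact (h.elim G.lt_of_adj G.lt_of_adj).false

/-- `m` is in `L` or is an ancestor of an element of `L`: the condition under which a collider `m`
does not block. -/
def HasDescendantIn (L : Finset (Fin n)) (m : Fin n) : Prop :=
  ∃ d ∈ L, Relation.ReflTransGen G.Adj m d

variable {G} {L : Finset (Fin n)}

theorem HasDescendantIn.of_mem {m : Fin n} (h : m ∈ L) : G.HasDescendantIn L m :=
  ⟨m, h, .refl⟩

theorem HasDescendantIn.of_adj {i j : Fin n} (h : G.HasDescendantIn L j) (hij : G.Adj i j) :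
    G.HasDescendantIn L i :=
  let ⟨d, hd, hjd⟩ := h
  ⟨d, hd, hjd.head hij⟩

variable (G L)

/-- The sequence `l` of nodes is active given `L`: no interior node of it blocks. -/
def IsActive (l : List (Fin n)) : Prop :=
  ∀ x m z : Fin n, [x, m, z] <:+: l →
    (G.Adj x m → G.Adj z m → G.HasDescendantIn L m) ∧ (¬(G.Adj x m ∧ G.Adj z m) → m ∉ L)

/-- `l` is the sequence of nodes of an active walk from `i` to `j`, possibly with repetitions. -/
structure IsActiveWalk (i j : Fin n) (l : List (Fin n)) : Prop where
  isChain : l.IsChain G.skeleton.Adj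
  head? : l.head? = some i
  getLast? : l.getLast? = some j
  isActive : G.IsActive L l

variable {G L}

theorem IsActive.of_infix {l l' : List (Fin n)} (h : G.IsActive L l) (hl : l' <:+: l) :
    G.IsActive L l' :=
  fun x m z hx => h x m z (hx.trans hl)

theorem IsActive.cons_cons_cons {x m z : Fin n} {l : List (Fin n)}
    (h : G.IsActive L (m :: z :: l))
    (h₁ : G.Adj x m → G.Adj z m → G.HasDescendantIn L m)
    (h₂ : ¬(G.Adj x m ∧ G.Adj z m) → m ∉ L) : G.IsActive L (x :: m :: z :: l) := by
  intro x' m' z' hx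
  rcases List.infix_cons_iff.1 hx with hx | hx
  · simp only [List.cons_prefix_cons, List.nil_prefix, and_true] at hx
    obtain ⟨rfl, rfl, rfl⟩ := hx
    exact ⟨h₁, h₂⟩
  · exact h x' m' z' hx

theorem isActive_of_length_le_two {l : List (Fin n)} (hl : l.length ≤ 2) : G.IsActive L l := by
  intro x m z hx
  have := hx.length_le
  simp only [List.length_cons, List.length_nil] at this
  omega

theorem isActiveWalk_singleton (i : Fin n) : G.IsActiveWalk L i i [i] :=
  ⟨.singleton i, rfl, rfl, isActive_of_length_le_two (by simp)⟩

/-- Prepending a node `i'` to an active walk from `i`. The new interior node is `i`. -/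
theorem IsActiveWalk.cons {i i' j : Fin n} {l : List (Fin n)} (h : G.IsActiveWalk L i j l)
    (hadj : G.Adj i i' ∨ G.Adj i' i)
    (h₁ : ∀ z ∈ l.tail.head?, G.Adj i' i → G.Adj z i → G.HasDescendantIn L i)
    (h₂ : ∀ z ∈ l.tail.head?, ¬(G.Adj i' i ∧ G.Adj z i) → i ∉ L) :
    G.IsActiveWalk L i' j (i' :: l) := by
  obtain ⟨hc, hh, hg, ha⟩ := h
  match l, hc, hh, hg, ha, h₁, h₂ with
  | [k], hc, hh, hg, ha, h₁, h₂ =>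
    obtain rfl : k = i := by simpa using hh
    obtain rfl : k = j := by simpa using hg
    exact ⟨.cons_cons (G.skeleton_adj.2 hadj.symm) hc, rfl, by simp,
      isActive_of_length_le_two (by simp)⟩
  | k :: z :: l, hc, hh, hg, ha, h₁, h₂ =>
    obtain rfl : k = i := by simpa using hh
    exact ⟨.cons_cons (G.skeleton_adj.2 hadj.symm) hc, rfl, by simpa using hg,
      ha.cons_cons_cons (h₁ z rfl) (h₂ z rfl)⟩

/-- An active walk that leaves `v` along an arrow and ends at a node whose label is at most that of
`v` cannot follow arrows all the way, so it meets a collider, which descends from `v`. -/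
theorem IsActive.hasDescendantIn_of_adj {l : List (Fin n)} : ∀ {v y : Fin n},
    (v :: y :: l).IsChain G.skeleton.Adj → G.IsActive L (v :: y :: l) → G.Adj v y →
    (∀ w ∈ (v :: y :: l).getLast?, w ≤ v) → G.HasDescendantIn L v := by
  induction l with
  | nil =>
    intro v y _ _ hvy hlast
    exact absurd (hlast y rfl) (G.lt_of_adj hvy).not_ge
  | cons z l ih =>
    intro v y hc ha hvy hlast
    have hc' : (y :: z :: l).IsChain G.skeleton.Adj := hc.of_cons
    refine HasDescendantIn.of_adj ?_ hvy
    rcases G.skeleton_adj.1 hc'.rel with hyz | hzy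
    · refine ih hc' (ha.of_infix (List.suffix_cons _ _).isInfix) hyz fun w hw => ?_
      exact (hlast w (by simpa using hw)).trans (G.lt_of_adj hvy).le
    · exact (ha v y z ⟨[], l, rfl⟩).1 hvy hzy

theorem _root_.List.infix_three_append_cons {α : Type*} {x m z v : α} {l₁ l₂ : List α}
    (h : [x, m, z] <:+: l₁ ++ v :: l₂) :
    [x, m, z] <:+: l₁ ++ [v] ∨ [x, m, z] <:+: v :: l₂ ∨
      (m = v ∧ (∃ l₁', l₁ = l₁' ++ [x]) ∧ ∃ l₂', l₂ = z :: l₂') := by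
  induction l₁ with
  | nil => exact .inr (.inl h)
  | cons a l₁ ih =>
    rw [List.cons_append] at h
    rcases List.infix_cons_iff.1 h with h | h
    · match l₁, h with
      | [], h =>
        match l₂, h with
        | [], h => simp at h
        | c :: l₂, h =>
          simp only [List.nil_append, List.cons_prefix_cons, List.nil_prefix, and_true] at h
          obtain ⟨rfl, rfl, rfl⟩ := h
          exact .inr (.inr ⟨rfl, ⟨[], rfl⟩, ⟨_, rfl⟩⟩)
      | [b], h =>
        simp only [List.cons_append, List.nil_append, List.cons_prefix_cons, List.nil_prefix,
          and_true] at h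
        obtain ⟨rfl, rfl, rfl⟩ := h
        exact .inl List.infix_rfl
      | b :: c :: l₁, h =>
        simp only [List.cons_append, List.cons_prefix_cons, List.nil_prefix, and_true] at h
        obtain ⟨rfl, rfl, rfl⟩ := h
        exact .inl ⟨[], l₁ ++ [v], by simp⟩
    · rcases ih h with h | h | ⟨h, ⟨l₁', h₁⟩, h₂⟩
      · exact .inl (List.infix_cons_iff.2 (.inr h))
      · exact .inr (.inl h)
      · exact .inr (.inr ⟨h, ⟨a :: l₁', by simp [h₁]⟩, h₂⟩)

theorem _root_.List.exists_eq_append_of_not_nodup {α : Type*} {l : List α} (h : ¬l.Nodup) :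
    ∃ l₁ l₂ l₃ v, l = l₁ ++ v :: (l₂ ++ v :: l₃) := by
  induction l with
  | nil => simp at h
  | cons a l ih =>
    rw [List.nodup_cons, not_and_or, not_not] at h
    rcases h with h | h
    · obtain ⟨l₂, l₃, rfl⟩ := List.append_of_mem h
      exact ⟨[], l₂, l₃, a, rfl⟩
    · obtain ⟨l₁, l₂, l₃, v, rfl⟩ := ih h
      exact ⟨a :: l₁, l₂, l₃, v, rfl⟩

/-- Excising a loop from an active walk leaves an active walk. If the excision turns `v` into a
collider, then either `v` was a collider before, or the loop left `v` along an arrow and, the graph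
being acyclic, met a collider that descends from `v`. -/
theorem IsActiveWalk.excise {i j v : Fin n} {l₁ l₂ l₃ : List (Fin n)}
    (h : G.IsActiveWalk L i j (l₁ ++ v :: (l₂ ++ v :: l₃))) :
    G.IsActiveWalk L i j (l₁ ++ v :: l₃) := by
  obtain ⟨hc, hh, hg, ha⟩ := h
  have hpre : l₁ ++ [v] <:+: l₁ ++ v :: (l₂ ++ v :: l₃) := ⟨[], l₂ ++ v :: l₃, by simp⟩
  have hsuf : v :: l₃ <:+: l₁ ++ v :: (l₂ ++ v :: l₃) := ⟨l₁ ++ v :: l₂, [], by simp⟩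
  have hloop : v :: (l₂ ++ [v]) <:+: l₁ ++ v :: (l₂ ++ v :: l₃) := ⟨l₁, l₃, by simp⟩
  refine ⟨?_, ?_, ?_, ?_⟩
  · exact List.isChain_split.2 ⟨hc.infix hpre, hc.infix hsuf⟩
  · cases l₁ <;> simpa using hh
  · rw [← hg]
    simp [List.getLast?_append, List.getLast?_cons]
  · intro x m z hx
    rcases List.infix_three_append_cons hx with hx | hx | ⟨rfl, ⟨l₁', rfl⟩, ⟨l₃', rfl⟩⟩
    · exact ha x m z (hx.trans hpre)
    · exact ha x m z (hx.trans hsuf)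
    · obtain ⟨y₁, r₁, hy₁⟩ : ∃ y r, l₂ ++ [m] = y :: r := List.exists_cons_of_ne_nil (by simp)
      obtain ⟨r₂, y₂, hy₂⟩ : ∃ r y, m :: l₂ = r ++ [y] :=
        ⟨_, _, (List.dropLast_append_getLast (by simp)).symm⟩
      have hfirst := ha x m y₁ ⟨l₁', r₁ ++ z :: l₃', by
        have : l₂ ++ m :: z :: l₃' = y₁ :: (r₁ ++ z :: l₃') := by
          rw [← List.cons_append, ← hy₁]; simp
        simp [this]⟩
      have hlast := ha y₂ m z ⟨l₁' ++ [x] ++ r₂, l₃', by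
        have : m :: (l₂ ++ m :: z :: l₃') = r₂ ++ [y₂] ++ m :: z :: l₃' := by
          rw [← hy₂]; simp
        simp [this]⟩
      rw [hy₁] at hloop
      refine ⟨fun hxm hzm => ?_, fun hncoll hmL => ?_⟩
      · -- The excised walk has a new collider `m`; `y₁` is the first node of the loop.
        have hc' := hc.infix hloop
        rcases G.skeleton_adj.1 hc'.rel with hmy | hym
        · refine (ha.of_infix hloop).hasDescendantIn_of_adj hc' hmy fun w hw => ?_
          rw [← hy₁] at hw
          have : w = m := by simpa [List.getLast?_cons, eq_comm] using hw
          exact this.le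
        · exact hfirst.1 hxm hym
      · -- Both visits to `m ∈ L` are colliders, hence so is `m` after the excision.
        have h₁ : G.Adj x m ∧ G.Adj y₁ m := by_contra fun h => hfirst.2 h hmL
        have h₂ : G.Adj y₂ m ∧ G.Adj z m := by_contra fun h => hlast.2 h hmL
        exact hncoll ⟨h₁.1, h₂.2⟩

theorem IsActiveWalk.exists_nodup {i j : Fin n} {l : List (Fin n)} (h : G.IsActiveWalk L i j l) :
    ∃ l', G.IsActiveWalk L i j l' ∧ l'.Nodup := by
  induction hk : l.length using Nat.strong_induction_on generalizing l with
  | _ k ih =>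
    by_cases hl : l.Nodup
    · exact ⟨l, h, hl⟩
    · obtain ⟨l₁, l₂, l₃, v, rfl⟩ := List.exists_eq_append_of_not_nodup hl
      refine ih _ ?_ h.excise rfl
      rw [← hk]
      simp only [List.length_append, List.length_cons]
      omega

variable (G L) in
/-- `i` and `j` are d-separated by `L`: every path between them is blocked by `L`. -/
def DSeparates (i j : Fin n) : Prop :=
  ∀ p : G.skeleton.Walk i j, p.IsPath → G.Blocks L p

theorem DSeparates.not_isActiveWalk {i j : Fin n} (h : G.DSeparates L i j) (l : List (Fin n)) :
    ¬G.IsActiveWalk L j i l := by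
  intro hw
  obtain ⟨l, ⟨hc, hh, hg, ha⟩, hnd⟩ := hw.exists_nodup
  have hne : l ≠ [] := by rintro rfl; simp at hh
  have hhead : l.head hne = j := by
    rw [List.head?_eq_some_head hne] at hh; exact Option.some.inj hh
  have hlast : l.getLast hne = i := by
    rw [List.getLast?_eq_some_getLast hne] at hg; exact Option.some.inj hg
  let p : G.skeleton.Walk i j := ((SimpleGraph.Walk.ofSupport l hne hc).copy hhead hlast).reverse
  have hp : p.support = l.reverse := by simp [p, SimpleGraph.Walk.support_ofSupport]
  obtain ⟨x, m, z, hx, hb⟩ := h p (by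
    rw [SimpleGraph.Walk.isPath_def, hp, List.nodup_reverse]; exact hnd)
  have hx' : [z, m, x] <:+: l := by
    rw [hp, ← List.reverse_infix, List.reverse_reverse] at hx
    simpa using hx
  obtain ⟨h₁, h₂⟩ := ha z m x hx'
  rcases hb with ⟨hxm, hzm, hmL, hd⟩ | ⟨hnc, hmL⟩
  · obtain ⟨d, hdL, hmd⟩ := h₁ hzm hxm
    rcases Relation.reflTransGen_iff_eq_or_transGen.1 hmd with rfl | hmd
    · exact hmL hdL
    · exact hd d hmd hdL
  · exact h₂ (fun h => hnc h.symm) hmL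

variable (G L) in
/-- There is an active walk from `w` to `i`. -/
def Reaches (i w : Fin n) : Prop := ∃ l, G.IsActiveWalk L w i l

theorem Reaches.of_adj {i w w' : Fin n} (h : G.Reaches L i w) (hw : w ∉ L) (hadj : G.Adj w w') :
    G.Reaches L i w' :=
  let ⟨_, hl⟩ := h
  ⟨_, hl.cons (.inl hadj)
    (fun _ _ h => absurd (G.lt_of_adj h) (G.lt_of_adj hadj).asymm) (fun _ _ _ => hw)⟩

theorem Reaches.of_adj_symm {i w w' : Fin n} (h : G.Reaches L i w) (hw : w ∉ L)
    (hd : G.HasDescendantIn L w) (hadj : G.Adj w' w) : G.Reaches L i w' :=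
  let ⟨_, hl⟩ := h
  ⟨_, hl.cons (.inr hadj) (fun _ _ _ _ => hd) (fun _ _ _ => hw)⟩

theorem Reaches.of_adj_adj {i v w w' : Fin n} (h : G.Reaches L i w) (hw : w ∉ L)
    (hadj : G.Adj w v) (hd : G.HasDescendantIn L v) (hadj' : G.Adj w' v) : G.Reaches L i w' := by
  obtain ⟨l, hl⟩ := h
  refine ⟨_, (hl.cons (.inl hadj) (fun _ _ h => absurd (G.lt_of_adj h) (G.lt_of_adj hadj).asymm)
    (fun _ _ _ => hw)).cons (.inr hadj') (fun _ _ _ _ => hd) fun z hz hnc => ?_⟩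
  obtain rfl : w = z := by
    have := hl.head?
    simp_all
  exact absurd ⟨hadj', hadj⟩ hnc

/-- An active walk can be continued along a directed path that avoids `L`. -/
theorem Reaches.of_reflTransGen {i w j : Fin n} (h : G.Reaches L i w)
    (hd : ¬G.HasDescendantIn L w) (hwj : Relation.ReflTransGen G.Adj w j) : G.Reaches L i j := by
  induction hwj using Relation.ReflTransGen.head_induction_on with
  | refl => exact h
  | head hab _ ih =>
    exact ih (h.of_adj (fun hL => hd (.of_mem hL)) hab) fun h' => hd (h'.of_adj hab)

/-- If `v` is an ancestor of `i` but not of `L`, then a directed path from `v` to `i` is active,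
also after the addition of a parent of `v`. -/
theorem exists_isActiveWalk_of_reflTransGen {i v : Fin n} (hvi : Relation.ReflTransGen G.Adj v i)
    (hd : ¬G.HasDescendantIn L v) :
    ∃ l, G.IsActiveWalk L v i l ∧ ∀ w, G.Adj w v → G.IsActiveWalk L w i (w :: l) := by
  induction hvi using Relation.ReflTransGen.head_induction_on with
  | refl =>
    exact ⟨[i], isActiveWalk_singleton i, fun w hw =>
      (isActiveWalk_singleton i).cons (.inr hw) (by simp) (by simp)⟩
  | @head a c hac _ ih =>
    obtain ⟨l, hl, hl'⟩ := ih fun h' => hd (h'.of_adj hac)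
    refine ⟨a :: l, hl' a hac, fun w hw => (hl' a hac).cons (.inr hw) (fun z hz _ hza => ?_)
      fun _ _ _ hL => hd (.of_mem hL)⟩
    obtain rfl : c = z := by
      have := hl.head?
      simp_all
    exact absurd (G.lt_of_adj hac) (G.lt_of_adj hza).asymm

variable (G L) in
/-- The nodes which are in `L ∪ {i, j}` or are ancestors of one of these. -/
def Relevant (i j v : Fin n) : Prop :=
  G.HasDescendantIn L v ∨ Relation.ReflTransGen G.Adj v i ∨ Relation.ReflTransGen G.Adj v j

theorem Relevant.of_adj {i j v w : Fin n} (h : G.Relevant L i j v) (hw : G.Adj w v) :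
    G.Relevant L i j w :=
  h.imp (fun h => h.of_adj hw) (Or.imp (fun h => h.head hw) fun h => h.head hw)

/-- If `L` d-separates `i` and `j`, then for a relevant node `v` the nodes outside `L` among `v`
and its parents are either all reached from `i` by active walks, or none of them is. -/
theorem DSeparates.reaches_of_family {i j v w w' : Fin n} (h : G.DSeparates L i j)
    (hv : G.Relevant L i j v) (hw : w = v ∨ G.Adj w v) (hwL : w ∉ L)
    (hw' : w' = v ∨ G.Adj w' v) (hreach : G.Reaches L i w) : G.Reaches L i w' := by
  by_cases hd : G.HasDescendantIn L v
  · rcases hw with rfl | hw <;> rcases hw' with rfl | hw'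
    · exact hreach
    · exact hreach.of_adj_symm hwL hd hw'
    · exact hreach.of_adj hwL hw
    · exact hreach.of_adj_adj hwL hw hd hw'
  · have hvreach : G.Reaches L i v := by
      rcases hw with rfl | hw
      · exact hreach
      · exact hreach.of_adj hwL hw
    rcases hw' with rfl | hw'
    · exact hvreach
    · -- As `v` is not an ancestor of `L`, it is an ancestor of `i`, and a path from `i` arrives at
      -- `v` against the arrows, or one of `j`, and then `j` would be reached from `i`.
      rcases hv with hv | hv | hv
      · exact absurd hv hd
      · obtain ⟨l, -, hl⟩ := exists_isActiveWalk_of_reflTransGen hv hd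
        exact ⟨_, hl w' hw'⟩
      · obtain ⟨l, hl⟩ := hvreach.of_reflTransGen hd hv
        exact absurd hl (h.not_isActiveWalk l)

end DAG

/-! ### The global Markov property -/

namespace StructuralFunctions

variable {n : ℕ} {G : DAG n} {X U : Fin n → Type*}
  [∀ i, MeasurableSpace (X i)] [∀ i, MeasurableSpace (U i)]

theorem variableAt_eq (F : StructuralFunctions G X U) {Ω : Type*} (E : ∀ i, Ω → U i) (i : Fin n)
    (ω : Ω) :
    F.variableAt E i ω = F.f i (fun j => F.variableAt E j.1 ω) (E i ω) := by
  rw [variableAt, solve]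
  rfl

theorem measurable_variableAt_of_parents (F : StructuralFunctions G X U) {Ω : Type*}
    {m : MeasurableSpace Ω} {E : ∀ i, Ω → U i} {i : Fin n}
    (hpa : ∀ j, G.Adj j i → Measurable (F.variableAt E j)) (hE : Measurable (E i)) :
    Measurable (F.variableAt E i) := by
  have : F.variableAt E i = (fun q : (∀ j : G.Parents i, X j) × U i => F.f i q.1 q.2) ∘
      fun ω => (fun j => F.variableAt E j.1 ω, E i ω) :=
    funext fun ω => F.variableAt_eq E i ω
  rw [this]
  exact (F.measurable_f i).comp ((measurable_pi_lambda _ fun j => hpa j.1 j.2).prodMk hE)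

theorem measurable_variableAt (F : StructuralFunctions G X U) {Ω : Type*} {m : MeasurableSpace Ω}
    {E : ∀ i, Ω → U i} (hE : ∀ i, Measurable (E i)) (i : Fin n) :
    Measurable (F.variableAt E i) := by
  induction i using WellFoundedLT.induction with
  | _ i ih => exact F.measurable_variableAt_of_parents (fun j hj => ih j (G.lt_of_adj hj)) (hE i)

theorem measurable_vectorAt (F : StructuralFunctions G X U) {Ω : Type*} {m : MeasurableSpace Ω}
    {E : ∀ i, Ω → U i} (hE : ∀ i, Measurable (E i)) (L : Finset (Fin n)) :
    Measurable (F.vectorAt E L) :=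
  measurable_pi_lambda _ fun j => F.measurable_variableAt hE j.1

/-- The σ-algebra generated by the disturbances of the nodes in `S`. -/
abbrev disturbanceSigma {Ω : Type*} (E : ∀ i, Ω → U i) (S : Set (Fin n)) : MeasurableSpace Ω :=
  ⨆ i ∈ S, MeasurableSpace.comap (E i) inferInstance

theorem measurable_disturbanceSigma {Ω : Type*} {E : ∀ i, Ω → U i} {S : Set (Fin n)} {i : Fin n}
    (hi : i ∈ S) : Measurable[disturbanceSigma E S] (E i) :=
  measurable_iff_comap_le.2
    (le_iSup₂_of_le (f := fun i (_ : i ∈ S) => MeasurableSpace.comap (E i) inferInstance)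
      i hi le_rfl)

theorem disturbanceSigma_le {Ω : Type*} {mΩ : MeasurableSpace Ω} {E : ∀ i, Ω → U i}
    (hE : ∀ i, Measurable (E i)) (S : Set (Fin n)) : disturbanceSigma E S ≤ mΩ :=
  iSup₂_le fun i _ => (hE i).comap_le

theorem indep_disturbanceSigma {Ω : Type*} {mΩ : MeasurableSpace Ω} {P : Measure Ω}
    {E : ∀ i, Ω → U i} (hE : ∀ i, Measurable (E i)) (hindep : iIndepFun E P) (S : Set (Fin n)) :
    Indep (disturbanceSigma E S) (disturbanceSigma E Sᶜ) P :=
  indep_iSup_of_disjoint (fun i => (hE i).comap_le) hindep disjoint_compl_right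

/-- The transcript up to label `k`: the σ-algebra generated by the variables attached to the nodes
of `L` with label less than `k`. -/
abbrev transcript (F : StructuralFunctions G X U) {Ω : Type*} (E : ∀ i, Ω → U i)
    (L : Finset (Fin n)) (k : ℕ) : MeasurableSpace Ω :=
  ⨆ (j : Fin n) (_ : j ∈ L ∧ (j : ℕ) < k), MeasurableSpace.comap (F.variableAt E j) inferInstance

variable (F : StructuralFunctions G X U) {Ω : Type*} {E : ∀ i, Ω → U i} {L : Finset (Fin n)}

theorem comap_le_transcript {j : Fin n} {k : ℕ} (hj : j ∈ L) (hk : (j : ℕ) < k) :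
    MeasurableSpace.comap (F.variableAt E j) inferInstance ≤ F.transcript E L k :=
  le_iSup₂_of_le (f := fun (j : Fin n) (_ : j ∈ L ∧ (j : ℕ) < k) =>
    MeasurableSpace.comap (F.variableAt E j) inferInstance) j ⟨hj, hk⟩ le_rfl

theorem transcript_mono {k k' : ℕ} (h : k ≤ k') : F.transcript E L k ≤ F.transcript E L k' :=
  iSup₂_le fun _ hj => F.comap_le_transcript hj.1 (hj.2.trans_le h)

theorem transcript_le {mΩ : MeasurableSpace Ω} (hE : ∀ i, Measurable (E i)) (k : ℕ) :
    F.transcript E L k ≤ mΩ :=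
  iSup₂_le fun j _ => (F.measurable_variableAt hE j).comap_le

theorem transcript_zero : F.transcript E L 0 = ⊥ := by
  simp [transcript]

theorem transcript_succ_of_mem {j : Fin n} (hj : j ∈ L) :
    F.transcript E L (j + 1) =
      F.transcript E L j ⊔ MeasurableSpace.comap (F.variableAt E j) inferInstance := by
  apply le_antisymm
  · refine iSup₂_le fun i hi => ?_
    rcases (Nat.lt_succ_iff.1 hi.2).lt_or_eq with h | h
    · exact (F.comap_le_transcript hi.1 h).trans le_sup_left
    · rw [Fin.ext h]
      exact le_sup_right
  · exact sup_le (F.transcript_mono (Nat.le_succ _)) (F.comap_le_transcript hj (Nat.lt_succ_self _))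

theorem transcript_succ_of_notMem {k : ℕ} (hk : ∀ j ∈ L, (j : ℕ) ≠ k) :
    F.transcript E L (k + 1) = F.transcript E L k :=
  le_antisymm
    (iSup₂_le fun j hj => F.comap_le_transcript hj.1
      ((Nat.lt_succ_iff.1 hj.2).lt_of_ne (hk j hj.1)))
    (F.transcript_mono (Nat.le_succ _))

theorem comap_vectorAt :
    MeasurableSpace.comap (F.vectorAt E L) inferInstance = F.transcript E L n := by
  have h : MeasurableSpace.comap (F.vectorAt E L) inferInstance =
      ⨆ j : L, MeasurableSpace.comap (F.variableAt E j) inferInstance := by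
    change MeasurableSpace.comap _ (⨆ _, _) = _
    rw [MeasurableSpace.comap_iSup]
    simp_rw [MeasurableSpace.comap_comp]
    rfl
  rw [h]
  exact le_antisymm (iSup_le fun j => F.comap_le_transcript j.2 j.1.2)
    (iSup₂_le fun j hj => le_iSup_of_le (⟨j, hj.1⟩ : L) le_rfl)

/-- Let `D` be a set of nodes closed under parents and let the party `Q` hold the disturbances of
the nodes in `Q`. If with each node of `Q` in `D` its parents outside `L` belong to `Q` too, then
the party can compute the variables attached to its nodes from its disturbances and from those
variables of `L` that come earlier. -/
theorem measurable_variableAt_party {D Q : Set (Fin n)}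
    (hD : ∀ v ∈ D, ∀ j, G.Adj j v → j ∈ D)
    (hQ : ∀ v ∈ D, v ∈ Q → ∀ j, G.Adj j v → j ∉ L → j ∈ Q) {v : Fin n} (hv : v ∈ D)
    (hvQ : v ∈ Q) :
    Measurable[disturbanceSigma E Q ⊔ F.transcript E L v] (F.variableAt E v) := by
  induction v using WellFoundedLT.induction with
  | _ v ih =>
    refine @measurable_variableAt_of_parents n G X U _ _ F Ω
      (disturbanceSigma E Q ⊔ F.transcript E L v) E v (fun j hj => ?_)
      ((measurable_disturbanceSigma hvQ).mono le_sup_left le_rfl)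
    have hjv := G.lt_of_adj hj
    by_cases hjL : j ∈ L
    · exact measurable_iff_comap_le.2 ((F.comap_le_transcript hjL hjv).trans le_sup_right)
    · exact (ih j hjv (hD v hv j hj) (hQ v hv hvQ j hj hjL)).mono
        (sup_le_sup_left (F.transcript_mono hjv.le) _) le_rfl

/-- The private disturbances of two parties are conditionally independent given the transcript of
their conversation, in which each variable of `L` is announced by one of the parties. -/
theorem condIndepSigma_transcript {mΩ : MeasurableSpace Ω} {P : Measure Ω}
    [IsProbabilityMeasure P] (hE : ∀ i, Measurable (E i)) (hindep : iIndepFun E P)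
    {S : Set (Fin n)}
    (hS : ∀ v ∈ L, v ∈ S →
      Measurable[disturbanceSigma E S ⊔ F.transcript E L v] (F.variableAt E v))
    (hSc : ∀ v ∈ L, v ∈ Sᶜ →
      Measurable[disturbanceSigma E Sᶜ ⊔ F.transcript E L v] (F.variableAt E v)) (k : ℕ) :
    CondIndepSigma (F.transcript E L k) (disturbanceSigma E S) (disturbanceSigma E Sᶜ) P := by
  have h₁ := disturbanceSigma_le hE S
  have h₂ := disturbanceSigma_le hE Sᶜ
  induction k with
  | zero =>
    rw [transcript_zero]
    exact .of_indep h₁ h₂ (indep_disturbanceSigma hE hindep S)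
  | succ k ih =>
    by_cases hk : ∃ j ∈ L, (j : ℕ) = k
    · obtain ⟨j, hj, rfl⟩ := hk
      rw [F.transcript_succ_of_mem hj]
      by_cases hjS : j ∈ S
      · exact ih.extend_left (F.transcript_le hE _) h₁ h₂ (hS j hj hjS).comap_le
      · exact ih.extend_right (F.transcript_le hE _) h₁ h₂ (hSc j hj hjS).comap_le
    · push Not at hk
      rwa [F.transcript_succ_of_notMem hk]

/-- The global Markov property of a structural causal model, for two single nodes. -/
theorem condIndepGiven_of_dSeparates {mΩ : MeasurableSpace Ω} {P : Measure Ω}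
    [IsProbabilityMeasure P] (hE : ∀ i, Measurable (E i)) (hindep : iIndepFun E P) {A Y : Fin n}
    (h : G.DSeparates L A Y) :
    CondIndepGiven P (F.variableAt E Y) (F.variableAt E A) (F.vectorAt E L) := by
  -- The first party owns the nodes that have, among themselves and their parents, a node outside
  -- `L` that is reached from `A` by an active walk.
  let S : Set (Fin n) := {v | ∃ w, (w = v ∨ G.Adj w v) ∧ w ∉ L ∧ G.Reaches L A w}
  let D : Set (Fin n) := {v | G.Relevant L A Y v}
  have hD : ∀ v ∈ D, ∀ j, G.Adj j v → j ∈ D := fun v hv j hj => DAG.Relevant.of_adj hv hj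
  have hS : ∀ v ∈ D, v ∈ S → ∀ j, G.Adj j v → j ∉ L → j ∈ S := by
    rintro v hv ⟨w, hw, hwL, hreach⟩ j hj hjL
    exact ⟨j, .inl rfl, hjL, h.reaches_of_family hv hw hwL (.inr hj) hreach⟩
  have hSc : ∀ v ∈ D, v ∈ Sᶜ → ∀ j, G.Adj j v → j ∉ L → j ∈ Sᶜ := by
    rintro v hv hvS j hj hjL ⟨w, hw, hwL, hreach⟩
    exact hvS ⟨j, .inr hj, hjL, h.reaches_of_family (hD v hv j hj) hw hwL (.inl rfl) hreach⟩
  have hLD : ∀ v ∈ L, v ∈ D := fun v hv => .inl (.of_mem hv)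
  have hAD : A ∈ D := .inr (.inl .refl)
  have hYD : Y ∈ D := .inr (.inr .refl)
  have hYS : Y ∈ Sᶜ := by
    rintro ⟨w, hw, hwL, hreach⟩
    obtain ⟨l, hl⟩ := h.reaches_of_family hYD hw hwL (.inl rfl) hreach
    exact h.not_isActiveWalk l hl
  have hT := F.transcript_le (L := L) hE n
  have hCI := (F.condIndepSigma_transcript hE hindep
    (fun v hv => F.measurable_variableAt_party hD hS (hLD v hv))
    (fun v hv => F.measurable_variableAt_party hD hSc (hLD v hv)) n).sup_sup hT
    (disturbanceSigma_le hE S) (disturbanceSigma_le hE Sᶜ)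
  have hA : Measurable[disturbanceSigma E S ⊔ F.transcript E L n] (F.variableAt E A) := by
    by_cases hAL : A ∈ L
    · exact measurable_iff_comap_le.2 ((F.comap_le_transcript hAL A.2).trans le_sup_right)
    · have hAS : A ∈ S := ⟨A, .inl rfl, hAL, _, DAG.isActiveWalk_singleton A⟩
      exact (F.measurable_variableAt_party hD hS hAD hAS).mono
        (sup_le_sup_left (F.transcript_mono A.2.le) _) le_rfl
  have hY : Measurable[disturbanceSigma E Sᶜ ⊔ F.transcript E L n] (F.variableAt E Y) :=
    (F.measurable_variableAt_party hD hSc hYD hYS).mono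
      (sup_le_sup_left (F.transcript_mono Y.2.le) _) le_rfl
  intro s t hs ht
  rw [comap_vectorAt]
  exact hCI.symm _ _ (hY hs) (hA ht)

end StructuralFunctions

/-! ### Splitting the node of intervention -/

namespace DAG

variable {n : ℕ} (G : DAG n)

/-- The graph `G` with all arrows out of the node `A` removed. -/
def removeOut (A : Fin n) : DAG n where
  Adj i j := G.Adj i j ∧ i ≠ A
  lt_of_adj h := G.lt_of_adj h.1

variable {G}

theorem skeleton_removeOut_le (A : Fin n) : (G.removeOut A).skeleton ≤ G.skeleton := by
  intro i j h
  exact G.skeleton_adj.2 (((G.removeOut A).skeleton_adj.1 h).imp And.left And.left)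

/-- Arrows between nodes that are joined in `G.removeOut A` have survived the removal. -/
theorem removeOut_adj_of_skeleton_adj {A i j : Fin n} (h : (G.removeOut A).skeleton.Adj i j)
    (hij : G.Adj i j) : (G.removeOut A).Adj i j :=
  ((G.removeOut A).skeleton_adj.1 h).resolve_right
    fun h' => (G.lt_of_adj hij).asymm (G.lt_of_adj h'.1)

/-- If `L` blocks all back-door paths from `A` to `Y`, then it d-separates `A` and `Y` in the graph
without the arrows out of `A`, because every path that starts at `A` there is a back-door path. -/
theorem dSeparates_removeOut {L : Finset (Fin n)} {A Y : Fin n} (hAY : A ≠ Y)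
    (hblock : ∀ p : G.skeleton.Walk A Y, G.IsBackDoorPath p → G.Blocks L p) :
    (G.removeOut A).DSeparates L A Y := by
  intro p hp
  have hle := G.skeleton_removeOut_le A
  have hbd : G.IsBackDoorPath (p.mapLe hle) := by
    refine ⟨(SimpleGraph.Walk.isPath_mapLe hle).2 hp, SimpleGraph.Walk.not_nil_of_ne hAY, ?_⟩
    cases p with
    | nil => exact absurd rfl hAY
    | cons h q =>
      rcases (G.removeOut A).skeleton_adj.1 h with h | h
      · exact absurd rfl h.2
      · simpa using h.1
  obtain ⟨x, m, z, hx, hb⟩ := hblock _ hbd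
  rw [SimpleGraph.Walk.support_mapLe_eq_support] at hx
  have hc := p.isChain_adj_support.infix hx
  have hxm : (G.removeOut A).skeleton.Adj x m := hc.rel
  have hmz : (G.removeOut A).skeleton.Adj m z := hc.of_cons.rel
  refine ⟨x, m, z, hx, hb.imp ?_ ?_⟩
  · rintro ⟨h₁, h₂, hm, hd⟩
    exact ⟨removeOut_adj_of_skeleton_adj hxm h₁, removeOut_adj_of_skeleton_adj hmz.symm h₂, hm,
      fun d hdm => hd d
        (Relation.TransGen.mono (r := (G.removeOut A).Adj) (fun _ _ h => h.1) m d hdm)⟩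
  · rintro ⟨h, hm⟩
    exact ⟨fun h' => h ⟨h'.1.1, h'.2.1⟩, hm⟩

theorem not_isDescendant_self (A : Fin n) : ¬G.IsDescendant A A := by
  intro h
  have : ∀ j, Relation.TransGen G.Adj A j → A < j := fun j hj => by
    induction hj with
    | single h => exact G.lt_of_adj h
    | tail _ h ih => exact ih.trans (G.lt_of_adj h)
  exact (this A h).false

end DAG

namespace StructuralFunctions

variable {n : ℕ} {G : DAG n} {X U : Fin n → Type*}
  [∀ i, MeasurableSpace (X i)] [∀ i, MeasurableSpace (U i)]

/-- The structural functions obtained by splitting the node `A`: the node keeps its own function,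
but the children of `A` receive the constant `a` in place of its value. -/
def split (F : StructuralFunctions G X U) (A : Fin n) (a : X A) :
    StructuralFunctions (G.removeOut A) X U where
  f i pa u := F.f i (fun j => if h : j.1 = A then h ▸ a else pa ⟨j.1, j.2, h⟩) u
  measurable_f i := by
    have h : Measurable fun (pa : ∀ j : (G.removeOut A).Parents i, X j) (j : G.Parents i) =>
        (if h : j.1 = A then h ▸ a else pa ⟨j.1, j.2, h⟩ : X j) := by
      rw [measurable_pi_iff]
      intro j
      by_cases h : j.1 = A
      · simp only [dif_pos h]
        exact measurable_const
      · simp only [dif_neg h]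
        exact measurable_pi_apply _
    exact (F.measurable_f i).comp ((h.comp measurable_fst).prodMk measurable_snd)

variable (F : StructuralFunctions G X U) {Ω : Type*} (E : ∀ i, Ω → U i)

theorem variableAt_intervene_self (A : Fin n) (a : X A) (ω : Ω) :
    (F.intervene A a).variableAt E A ω = a := by
  rw [variableAt_eq]
  simp [intervene]

theorem variableAt_intervene_of_ne {A i : Fin n} (a : X A) (hi : i ≠ A) (ω : Ω) :
    (F.intervene A a).variableAt E i ω =
      F.f i (fun j => (F.intervene A a).variableAt E j.1 ω) (E i ω) := by
  rw [variableAt_eq]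
  simp [intervene, Function.update_of_ne hi]

/-- Away from `A`, the split model computes the counterfactual variables. -/
theorem variableAt_split_of_ne {A i : Fin n} (a : X A) (hi : i ≠ A) (ω : Ω) :
    (F.split A a).variableAt E i ω = (F.intervene A a).variableAt E i ω := by
  induction i using WellFoundedLT.induction with
  | _ i ih =>
    rw [F.variableAt_intervene_of_ne E a hi, variableAt_eq]
    refine congrArg (fun pa => F.f i pa (E i ω)) (funext fun j => ?_)
    by_cases h : j.1 = A
    · obtain ⟨j, hj⟩ := j
      obtain rfl : j = A := h
      simp [variableAt_intervene_self]
    · simp only [h, dite_false]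
      exact ih j.1 (G.lt_of_adj j.2) h

/-- At `A` and at the nodes that do not descend from `A`, the split model computes the factual
variables. -/
theorem variableAt_split_of_not_isDescendant {A i : Fin n} (a : X A)
    (hi : ¬G.IsDescendant i A) (ω : Ω) :
    (F.split A a).variableAt E i ω = F.variableAt E i ω := by
  induction i using WellFoundedLT.induction with
  | _ i ih =>
    rw [variableAt_eq, variableAt_eq]
    refine congrArg (fun pa => F.f i pa (E i ω)) (funext fun j => ?_)
    have h : j.1 ≠ A := fun h => hi (.single (h ▸ j.2))
    simp only [h, dite_false]
    exact ih j.1 (G.lt_of_adj j.2) fun hj => hi (hj.tail j.2)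

/-- Consistency: where the factual value at `A` is `a`, the counterfactual variables agree with the
factual ones. -/
theorem variableAt_intervene_of_eq {A : Fin n} {a : X A} {ω : Ω} (h : F.variableAt E A ω = a)
    (i : Fin n) : (F.intervene A a).variableAt E i ω = F.variableAt E i ω := by
  induction i using WellFoundedLT.induction with
  | _ i ih =>
    by_cases hi : i = A
    · subst hi
      rw [variableAt_intervene_self, h]
    · rw [F.variableAt_intervene_of_ne E a hi, variableAt_eq]
      exact congrArg (fun pa => F.f i pa (E i ω)) (funext fun j => ih j.1 (G.lt_of_adj j.2))

/-- The back-door criterion implies conditional ignorability. -/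
theorem condIndepGiven_intervene {mΩ : MeasurableSpace Ω} {P : Measure Ω}
    [IsProbabilityMeasure P] (hE : ∀ i, Measurable (E i)) (hindep : iIndepFun E P) {A Y : Fin n}
    {L : Finset (Fin n)} (hdesc : ∀ j ∈ L, ¬G.IsDescendant j A)
    (hblock : ∀ p : G.skeleton.Walk A Y, G.IsBackDoorPath p → G.Blocks L p) (a : X A) :
    CondIndepGiven P ((F.intervene A a).variableAt E Y) (F.variableAt E A) (F.vectorAt E L) := by
  by_cases hAY : A = Y
  · -- Here the counterfactual variable is the constant `a`.
    subst hAY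
    have hconst : (F.intervene A a).variableAt E A = fun _ => a :=
      funext fun ω => F.variableAt_intervene_self E A a ω
    have hm := (F.measurable_vectorAt hE L).comap_le
    intro s t _ _
    rw [hconst]
    by_cases ha : a ∈ s
    · have : (fun _ : Ω => a) ⁻¹' s = Set.univ := by ext; simp [ha]
      rw [this, Set.univ_inter, Set.indicator_univ, condExp_const hm]
      exact .of_forall fun ω => by simp
    · have : (fun _ : Ω => a) ⁻¹' s = ∅ := by ext; simp [ha]
      rw [this, Set.empty_inter, Set.indicator_empty]
      have h0 : P[fun _ : Ω => (0 : ℝ) | MeasurableSpace.comap (F.vectorAt E L) inferInstance]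
          = 0 := condExp_zero
      rw [h0, zero_mul]
  · have h := (F.split A a).condIndepGiven_of_dSeparates hE hindep
      (DAG.dSeparates_removeOut hAY hblock)
    have hY : (F.split A a).variableAt E Y = (F.intervene A a).variableAt E Y :=
      funext fun ω => F.variableAt_split_of_ne E a (Ne.symm hAY) ω
    have hA : (F.split A a).variableAt E A = F.variableAt E A :=
      funext fun ω => F.variableAt_split_of_not_isDescendant E a (DAG.not_isDescendant_self A) ω
    have hL : (F.split A a).vectorAt E L = F.vectorAt E L :=
      funext fun ω => funext fun j =>
        F.variableAt_split_of_not_isDescendant E a (hdesc j.1 j.2) ω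
    rwa [hY, hA, hL] at h

end StructuralFunctions

/-! ### The adjustment formula -/

/-- A conditional probability given `σ(L)` is constant on the event `L = l`. -/
theorem exists_condExp_eq_on_fiber {Ω γ : Type*} [MeasurableSpace Ω] [MeasurableSpace γ]
    (P : Measure Ω) [IsProbabilityMeasure P] {L : Ω → γ} (hL : Measurable L) {l : γ}
    (hl : MeasurableSet {l}) {s : Set Ω} (hs : MeasurableSet s) :
    ∃ c : ℝ, (∀ ω ∈ L ⁻¹' {l}, (P⟦s | MeasurableSpace.comap L inferInstance⟧) ω = c) ∧
      P.real (s ∩ L ⁻¹' {l}) = c * P.real (L ⁻¹' {l}) := by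
  have hg : StronglyMeasurable[MeasurableSpace.comap L inferInstance]
    (P⟦s | MeasurableSpace.comap L inferInstance⟧) := stronglyMeasurable_condExp
  obtain ⟨h, -, hh⟩ := hg.exists_eq_measurable_comp
  have hc : ∀ ω ∈ L ⁻¹' {l}, (P⟦s | MeasurableSpace.comap L inferInstance⟧) ω = h l := by
    intro ω hω
    rw [hh, Function.comp_apply, show L ω = l from hω]
  refine ⟨h l, hc, ?_⟩
  have hB : MeasurableSet (L ⁻¹' {l}) := hL hl
  have hint : ∫ ω in L ⁻¹' {l}, (P⟦s | MeasurableSpace.comap L inferInstance⟧) ω ∂P =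
      ∫ ω in L ⁻¹' {l}, s.indicator (fun _ => (1 : ℝ)) ω ∂P :=
    setIntegral_condExp hL.comap_le ((integrable_const 1).indicator hs) ⟨{l}, hl, rfl⟩
  rw [setIntegral_congr_fun hB hc, setIntegral_indicator hs] at hint
  simp only [setIntegral_const, smul_eq_mul, mul_one] at hint
  rw [Set.inter_comm, ← hint, mul_comm]

/-- Conditional independence given `L`, on the event `L = l`, in a form free of division. -/
theorem CondIndepGiven.measure_inter_mul {Ω α β γ : Type*} [MeasurableSpace Ω]
    [MeasurableSpace α] [MeasurableSpace β] [MeasurableSpace γ] {P : Measure Ω}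
    [IsProbabilityMeasure P] {Y : Ω → α} {A : Ω → β} {L : Ω → γ} (h : CondIndepGiven P Y A L)
    (hY : Measurable Y) (hA : Measurable A) (hL : Measurable L) {s : Set α} {t : Set β} {l : γ}
    (hs : MeasurableSet s) (ht : MeasurableSet t) (hl : MeasurableSet {l}) :
    P (Y ⁻¹' s ∩ A ⁻¹' t ∩ L ⁻¹' {l}) * P (L ⁻¹' {l}) =
      P (Y ⁻¹' s ∩ L ⁻¹' {l}) * P (A ⁻¹' t ∩ L ⁻¹' {l}) := by
  by_cases hB : P (L ⁻¹' {l}) = 0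
  · rw [hB, mul_zero, measure_mono_null Set.inter_subset_right hB, zero_mul]
  obtain ⟨c₁, hc₁, h₁⟩ := exists_condExp_eq_on_fiber P hL hl (hY hs)
  obtain ⟨c₂, hc₂, h₂⟩ := exists_condExp_eq_on_fiber P hL hl (hA ht)
  obtain ⟨c₃, hc₃, h₃⟩ := exists_condExp_eq_on_fiber P hL hl ((hY hs).inter (hA ht))
  have hc : c₃ = c₁ * c₂ := by
    -- Otherwise the almost sure identity fails on all of `L = l`, which is not a null event.
    by_contra hne
    refine hB (measure_mono_null (fun ω hω => ?_) (h s t hs ht))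
    intro hω'
    apply hne
    rw [← hc₁ ω hω, ← hc₂ ω hω, ← hc₃ ω hω]
    exact hω'
  rw [← ENNReal.toReal_eq_toReal_iff' (by finiteness) (by finiteness), ENNReal.toReal_mul,
    ENNReal.toReal_mul]
  change P.real _ * P.real _ = P.real _ * P.real _
  rw [h₁, h₂, h₃, hc]
  ring

theorem mainTheorem2 {n : ℕ} (G : DAG n) {X U : Fin n → Type*}
    [∀ i, MeasurableSpace (X i)] [∀ i, MeasurableSingletonClass (X i)]
    [∀ i, MeasurableSpace (U i)] (F : StructuralFunctions G X U)
    {Ω : Type*} [MeasurableSpace Ω] (P : Measure Ω) [IsProbabilityMeasure P]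
    (E : ∀ i, Ω → U i) (hE : ∀ i, Measurable (E i)) (hindep : iIndepFun E P)
    (A Y : Fin n) (L : Finset (Fin n)) (hAL : A ∉ L)
    (hdesc : ∀ j ∈ L, ¬ G.IsDescendant j A)
    (hblock : ∀ p : G.skeleton.Walk A Y, G.IsBackDoorPath p → G.Blocks L p)
    (a : X A) :
    CondIndepGiven P ((F.intervene A a).variableAt E Y) (F.variableAt E A) (F.vectorAt E L) ∧
    ((∀ j ∈ L, Countable (X j)) →
      (∀ l : (∀ j : L, X j), 0 < P {ω | F.vectorAt E L ω = l} →
        0 < P[{ω | F.variableAt E A ω = a} | {ω | F.vectorAt E L ω = l}]) →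
      ∀ y : X Y,
        P {ω | (F.intervene A a).variableAt E Y ω = y} =
          ∑' l : (∀ j : L, X j),
            P[{ω | F.variableAt E Y ω = y} |
                {ω | F.variableAt E A ω = a ∧ F.vectorAt E L ω = l}] *
              P {ω | F.vectorAt E L ω = l}) := by
  have hCI := F.condIndepGiven_intervene E hE hindep hdesc hblock a
  refine ⟨hCI, fun hcount hpos y => ?_⟩
  have : ∀ j : L, Countable (X j) := fun j => hcount j.1 j.2
  have hY := (F.intervene A a).measurable_variableAt hE Y
  have hA := F.measurable_variableAt hE A
  have hL := F.measurable_vectorAt hE L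
  have hfib : ∀ l, MeasurableSet {ω | F.vectorAt E L ω = l} :=
    fun l => hL (measurableSet_singleton l)
  have hsum : P {ω | (F.intervene A a).variableAt E Y ω = y} =
      ∑' l : (∀ j : L, X j),
        P ({ω | (F.intervene A a).variableAt E Y ω = y} ∩ {ω | F.vectorAt E L ω = l}) := by
    rw [← measure_iUnion]
    · congr 1
      ext ω
      simp
    · intro l l' hll'
      refine Set.disjoint_left.2 fun ω h h' => hll' ?_
      exact h.2.symm.trans h'.2
    · exact fun l => (hY (measurableSet_singleton y)).inter (hfib l)
  rw [hsum]
  refine tsum_congr fun l => ?_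
  by_cases hB : P {ω | F.vectorAt E L ω = l} = 0
  · rw [hB, mul_zero, measure_mono_null Set.inter_subset_right hB]
  have hpos' := hpos l (pos_iff_ne_zero.2 hB)
  rw [cond_apply (hfib l)] at hpos'
  have hD : P {ω | F.variableAt E A ω = a ∧ F.vectorAt E L ω = l} ≠ 0 := by
    intro h0
    rw [Set.inter_comm] at hpos'
    change 0 < _ * P {ω | F.variableAt E A ω = a ∧ F.vectorAt E L ω = l} at hpos'
    simp [h0] at hpos'
  have hDm : MeasurableSet {ω | F.variableAt E A ω = a ∧ F.vectorAt E L ω = l} :=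
    (hA (measurableSet_singleton a)).inter (hfib l)
  have hmul := hCI.measure_inter_mul hY hA hL (measurableSet_singleton y)
    (measurableSet_singleton a) (measurableSet_singleton l)
  -- By consistency, `Y` may be replaced by its counterfactual version on the event `A = a`.
  have hcons : {ω | F.variableAt E A ω = a ∧ F.vectorAt E L ω = l} ∩
      {ω | F.variableAt E Y ω = y} =
      (F.intervene A a).variableAt E Y ⁻¹' {y} ∩ F.variableAt E A ⁻¹' {a} ∩
        F.vectorAt E L ⁻¹' {l} := by
    ext ω
    constructor
    · rintro ⟨⟨h₁, h₂⟩, h₃⟩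
      exact ⟨⟨(F.variableAt_intervene_of_eq E h₁ Y).trans h₃, h₁⟩, h₂⟩
    · rintro ⟨⟨h₃, h₁⟩, h₂⟩
      exact ⟨⟨h₁, h₂⟩, (F.variableAt_intervene_of_eq E h₁ Y).symm.trans h₃⟩
  rw [cond_apply hDm, hcons, mul_assoc]
  change _ = _ * (_ * P (F.vectorAt E L ⁻¹' {l}))
  rw [hmul]
  change P ((F.intervene A a).variableAt E Y ⁻¹' {y} ∩ F.vectorAt E L ⁻¹' {l}) =
    (P (F.variableAt E A ⁻¹' {a} ∩ F.vectorAt E L ⁻¹' {l}))⁻¹ *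
      (P ((F.intervene A a).variableAt E Y ⁻¹' {y} ∩ F.vectorAt E L ⁻¹' {l}) *
        P (F.variableAt E A ⁻¹' {a} ∩ F.vectorAt E L ⁻¹' {l}))
  rw [mul_left_comm, show (P (F.variableAt E A ⁻¹' {a} ∩ F.vectorAt E L ⁻¹' {l}))⁻¹ *
    P (F.variableAt E A ⁻¹' {a} ∩ F.vectorAt E L ⁻¹' {l}) = 1 from
      ENNReal.inv_mul_cancel hD (measure_ne_top _ _), mul_one]
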